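/- **Setting.** Let $k\ge 2$, $m_1,\dots,m_k\in\mathbb R$, $\xi_1,\dots,\xi_k>0$, $\sigma_1,\dots,\sigma_k>0$. The prior $\boldsymbol H$ makes the means $\mu_1,\dots,\mu_k$ independent with $\mu_i\sim H_i=N(m_i,\xi_i^2)$; given $\boldsymbol\mu$, each sample of arm $i$ is drawn independently from $N(\mu_i,\sigma_i^2)$. A best arm identification (BAI) algorithm $\pi=((A_t),\tau,J)$, which may use internal randomness independent of the means and the rewards, chooses the arm $A_t$ to sample at round $t$ from the past arms and rewards, stops after $\tau\in\{0,1,2,\dots\}\cup\{\infty\}$ samples, where $\tau$ is a stopping time of the filtration $(\mathcal F_t)$ generated by the observations (and the internal randomness), and recommends an $\mathcal F_\tau$-measurable arm $J$. Put $$\mathrm{PoE}(\pi;\boldsymbol H)=\mathbb E_{\boldsymbol\mu\sim\boldsymbol H}\bigl[\mathbb P_{\boldsymbol\mu}(\mu_J<\max_i\mu_i)\bigr],\qquad \mathbb E_{\boldsymbol\mu\sim\boldsymbol H}[\tau]=\mathbb E_{\boldsymbol\mu\sim\boldsymbol H}\bigl[\mathbb E_{\boldsymbol\mu}[\tau]\bigr],$$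 and call $\pi$ Bayesian $(\boldsymbol H,\delta)$-correct if $\mathrm{PoE}(\pi;\boldsymbol H)\le\delta$. **Constants.** Write $h_i$ for the density of $N(m_i,\xi_i^2)$, $H_i(x)$ for its distribution function, and $$L(\boldsymbol H)=\sum_{i\ne j}\int_{-\infty}^{\infty}h_i(x)h_j(x)\prod_{s\ne i,j}H_s(x)\,dx .$$ Let $\xi_{\max}=\max_i\xi_i$, let $W_{-1}$ be the lower branch of the Lambert function ($W_{-1}(x)\le -1$ and $W_{-1}(x)e^{W_{-1}(x)}=x$ for $-1/e\le x<0$), and, with $1/0=\infty$, let $$D_0(\boldsymbol H)=\begin{cases}\dfrac{1}{16\,\xi_{\max}^2\,\bigl|W_{-1}\bigl(-\tfrac{1}{32\,\xi_{\max}^3}\bigr)\bigr|}&\text{if }\xi_{\max}^3>e/32,\\[2mm] 1&\text{otherwise,}\end{cases}$$ $$D_1(\boldsymbol H)=\min_{i\ne j}\min\left(\Bigl|\tfrac{m_i}{\xi_i^2}-\tfrac{m_j}{\xi_j^2}\Bigr|^{-1},\Bigl(\tfrac1{2\xi_i^2}+\tfrac1{2\xi_j^2}\Bigr)^{-2}\right),$$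 $$\delta_L(\boldsymbol H)=\frac{L(\boldsymbol H)}{32e^4}\min\left(D_0(\boldsymbol H),\,D_1(\boldsymbol H),\,\min_i\frac1{4m_i^2},\,\frac{L(\boldsymbol H)}{4(k-1)\sum_i 1/\xi_i^2}\right).$$ **Theorem.** Let $0<\delta<\delta_L(\boldsymbol H)$ and $$N_V=\frac{L(\boldsymbol H)^2\,(\min_i\sigma_i^2)\,\ln 2}{16e^4\,\delta}.$$ Then every BAI algorithm $\pi$ with $\mathbb E_{\boldsymbol\mu\sim\boldsymbol H}[\tau]\le N_V$ satisfies $\mathrm{PoE}(\pi;\boldsymbol H)\ge\delta$. Moreover, every Bayesian $(\boldsymbol H,\delta)$-correct algorithm satisfies $\mathbb E_{\boldsymbol\mu\sim\boldsymbol H}[\tau]\ge N_V$; in particular it needs $\Omega(L(\boldsymbol H)^2/\delta)$ samples in expectation. -/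

import Mathlib

open MeasureTheory ProbabilityTheory
open scoped ENNReal

namespace BAI

/-- The Gaussian distribution `N(c, s²)` with mean `c` and standard deviation `s`. -/
noncomputable def normal (c s : ℝ) : Measure ℝ := gaussianReal c (Real.toNNReal (s ^ 2))

instance (c s : ℝ) : IsProbabilityMeasure (normal c s) :=
  inferInstanceAs (IsProbabilityMeasure (gaussianReal c (Real.toNNReal (s ^ 2))))

/-- The density of `N(c, s²)`. -/
noncomputable def normalDensity (c s x : ℝ) : ℝ := gaussianPDFReal c (Real.toNNReal (s ^ 2)) x

/-! ### The prior and the constants attached to it -/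

/-- The prior: the means `μ₁, …, μ_k` are independent and `μ_i` has law `N(m_i, ξ_i²)`. -/
noncomputable def prior {k : ℕ} (m ξ : Fin k → ℝ) : Measure (Fin k → ℝ) :=
  Measure.pi fun i => normal (m i) (ξ i)

/-- `L_{ij} = ∫ h_i(x) h_j(x) ∏_{s ≠ i, j} H_s(x) dx`, where `h_s` is the density and `H_s` the
distribution function of `N(m_s, ξ_s²)`. -/
noncomputable def Lpair {k : ℕ} (m ξ : Fin k → ℝ) (i j : Fin k) : ℝ :=
  ∫ x : ℝ, normalDensity (m i) (ξ i) x * normalDensity (m j) (ξ j) x *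
    ∏ s ∈ Finset.univ \ {i, j}, cdf (normal (m s) (ξ s)) x

/-- `L(H) = ∑_{i ≠ j} L_{ij}`, the sum over ordered pairs. -/
noncomputable def L {k : ℕ} (m ξ : Fin k → ℝ) : ℝ :=
  ∑ i, ∑ j ∈ Finset.univ.erase i, Lpair m ξ i j

/-- The lower branch `W₋₁` of the Lambert function: for `-1/e ≤ x < 0`, the unique `w ≤ -1` with
`w * exp w = x`. -/
noncomputable def lambertLower (x : ℝ) : ℝ := sSup {w : ℝ | w ≤ -1 ∧ w * Real.exp w = x}

/-- `D₀(H)`; here `⨆ i, ξ i` is the largest prior standard deviation. -/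
noncomputable def D0 {k : ℕ} (ξ : Fin k → ℝ) : ℝ :=
  open Classical in
  if Real.exp 1 / 32 < (⨆ i, ξ i) ^ 3 then
    1 / (16 * (⨆ i, ξ i) ^ 2 * |lambertLower (-(1 / (32 * (⨆ i, ξ i) ^ 3)))|)
  else 1

/-- `D₁(H) = min_{i ≠ j} min (|m_i/ξ_i² - m_j/ξ_j²|⁻¹, (1/(2ξ_i²) + 1/(2ξ_j²))⁻²)`, with
`0⁻¹ = ∞`. -/
noncomputable def D1 {k : ℕ} (m ξ : Fin k → ℝ) : ℝ≥0∞ :=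
  ⨅ (i : Fin k) (j : Fin k) (_ : i ≠ j),
    min (ENNReal.ofReal |m i / ξ i ^ 2 - m j / ξ j ^ 2|)⁻¹
      (ENNReal.ofReal ((1 / (2 * ξ i ^ 2) + 1 / (2 * ξ j ^ 2)) ^ 2))⁻¹

/-- The threshold `δ_L(H)`, with the convention `1/(4 m_i²) = ∞` when `m_i = 0`. -/
noncomputable def deltaL {k : ℕ} (m ξ : Fin k → ℝ) : ℝ≥0∞ :=
  ENNReal.ofReal (L m ξ / (32 * Real.exp 4)) *
    min (min (ENNReal.ofReal (D0 ξ)) (D1 m ξ))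
      (min (⨅ i, (ENNReal.ofReal (4 * m i ^ 2))⁻¹)
        (ENNReal.ofReal (L m ξ / (4 * ((k : ℝ) - 1) * ∑ i, 1 / ξ i ^ 2))))

/-- `N_V = L(H)² (min_i σ_i²) ln 2 / (16 e⁴ δ)`. -/
noncomputable def NV {k : ℕ} (m ξ σ : Fin k → ℝ) (δ : ℝ) : ℝ :=
  L m ξ ^ 2 * (⨅ i, σ i ^ 2) * Real.log 2 / (16 * Real.exp 4 * δ)

/-! ### The bandit model -/

/-- Sample space: the forecaster's internal random seed, and a table whose entry `(t, i)` is the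
reward that arm `i` gives if it is the arm drawn in round `t` (rounds are numbered from `0`). -/
abbrev Outcome (k : ℕ) : Type := unitInterval × (ℕ → Fin k → ℝ)

/-- The law `ℙ_μ`: the seed is uniform on `[0, 1]`, the rewards are independent of it and of each
other, and those of arm `i` have law `N(μ_i, σ_i²)`. -/
noncomputable def law {k : ℕ} (σ μ : Fin k → ℝ) : Measure (Outcome k) :=
  (volume : Measure unitInterval).prod
    (Measure.infinitePi fun _ : ℕ => Measure.pi fun i => normal (μ i) (σ i))

/-- A sampling rule: the arm drawn in round `t`, as a measurable function of the seed and of the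
arms drawn and rewards observed in the `t` rounds before it. -/
structure SamplingRule (k : ℕ) where
  rule : (t : ℕ) → unitInterval × (Fin t → Fin k × ℝ) → Fin k
  measurable_rule : ∀ t, Measurable (rule t)

namespace SamplingRule

variable {k : ℕ}

/-- The arm drawn in round `t`. -/
def arm (S : SamplingRule k) (t : ℕ) (ω : Outcome k) : Fin k :=
  S.rule t (ω.1, fun s : Fin t => (S.arm s ω, ω.2 s (S.arm s ω)))
termination_by t
decreasing_by all_goals exact s.isLt

/-- The reward observed in round `t`. -/
def reward (S : SamplingRule k) (t : ℕ) (ω : Outcome k) : ℝ := ω.2 t (S.arm t ω)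

/-- What the forecaster knows after `t` rounds: the seed, and the first `t` arms and rewards. -/
def history (S : SamplingRule k) (t : ℕ) (ω : Outcome k) :
    unitInterval × (Fin t → Fin k × ℝ) :=
  (ω.1, fun s : Fin t => (S.arm s ω, S.reward s ω))

theorem arm_eq (S : SamplingRule k) (t : ℕ) (ω : Outcome k) :
    S.arm t ω = S.rule t (S.history t ω) := by
  rw [arm]; rfl

theorem measurable_arm (S : SamplingRule k) (t : ℕ) : Measurable (S.arm t) := by
  induction t using Nat.strong_induction_on with
  | _ t ih =>
    have h : S.arm t = fun ω => S.rule t (S.history t ω) := funext (S.arm_eq t)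
    rw [h]
    refine (S.measurable_rule t).comp (measurable_fst.prodMk (measurable_pi_lambda _ fun s => ?_))
    have e : Measurable fun p : (Fin k → ℝ) × Fin k => p.1 p.2 :=
      measurable_from_prod_countable_left fun i => measurable_pi_apply i
    exact (ih s s.isLt).prodMk
      (e.comp (((measurable_pi_apply (s : ℕ)).comp measurable_snd).prodMk (ih s s.isLt)))

theorem measurable_reward (S : SamplingRule k) (t : ℕ) : Measurable (S.reward t) := by
  have e : Measurable fun p : (Fin k → ℝ) × Fin k => p.1 p.2 :=
    measurable_from_prod_countable_left fun i => measurable_pi_apply i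
  exact e.comp (((measurable_pi_apply t).comp measurable_snd).prodMk (S.measurable_arm t))

theorem measurable_history (S : SamplingRule k) (t : ℕ) : Measurable (S.history t) :=
  measurable_fst.prodMk (measurable_pi_lambda _ fun s =>
    (S.measurable_arm s).prodMk (S.measurable_reward s))

/-- `ℱ_t`, generated by the seed and the first `t` arms and rewards. -/
def filtration (S : SamplingRule k) :
    Filtration ℕ (inferInstance : MeasurableSpace (Outcome k)) where
  seq t := MeasurableSpace.comap (S.history t) inferInstance
  mono' := by
    intro s t hst
    have h : S.history s = (fun p : unitInterval × (Fin t → Fin k × ℝ) =>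
        (p.1, fun r : Fin s => p.2 (Fin.castLE hst r))) ∘ S.history t := rfl
    have hm : Measurable (fun p : unitInterval × (Fin t → Fin k × ℝ) =>
        (p.1, fun r : Fin s => p.2 (Fin.castLE hst r))) :=
      measurable_fst.prodMk (measurable_pi_lambda _ fun r =>
        (measurable_pi_apply (Fin.castLE hst r)).comp measurable_snd)
    change MeasurableSpace.comap (S.history s) inferInstance ≤
      MeasurableSpace.comap (S.history t) inferInstance
    rw [h, ← MeasurableSpace.comap_comp]
    exact MeasurableSpace.comap_mono hm.comap_le
  le' t := (S.measurable_history t).comap_le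

end SamplingRule

/-- A best arm identification algorithm `((A_t), τ, J)`: a sampling rule, a stopping time `τ` (the
number of samples taken, possibly `0` or infinite), and an `ℱ_τ`-measurable recommendation `J`. -/
structure Algorithm (k : ℕ) extends SamplingRule k where
  τ : Outcome k → ℕ∞
  isStoppingTime_τ : IsStoppingTime toSamplingRule.filtration τ
  J : Outcome k → Fin k
  measurable_J : Measurable[isStoppingTime_τ.measurableSpace] J

namespace Algorithm

variable {k : ℕ}

/-- `PoE(π; μ)`: the probability under `ℙ_μ` that `J` is not a best arm. -/
noncomputable def poeAt (π : Algorithm k) (σ μ : Fin k → ℝ) : ℝ≥0∞ :=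
  law σ μ {ω | ¬ ∀ j, μ j ≤ μ (π.J ω)}

/-- `PoE(π; H) = 𝔼_{μ ∼ H} [PoE(π; μ)]`. -/
noncomputable def poe (π : Algorithm k) (m ξ σ : Fin k → ℝ) : ℝ≥0∞ :=
  ∫⁻ μ, π.poeAt σ μ ∂(prior m ξ)

/-- `𝔼_{μ ∼ H} [τ] = 𝔼_{μ ∼ H} [𝔼_μ [τ]]`. -/
noncomputable def expectedTime (π : Algorithm k) (m ξ σ : Fin k → ℝ) : ℝ≥0∞ :=
  ∫⁻ μ, ∫⁻ ω, (π.τ ω : ℝ≥0∞) ∂(law σ μ) ∂(prior m ξ)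

/-- Bayesian `(H, δ)`-correctness. -/
def IsBayesCorrect (π : Algorithm k) (m ξ σ : Fin k → ℝ) (δ : ℝ) : Prop :=
  π.poe m ξ σ ≤ ENNReal.ofReal δ

end Algorithm

end BAI

/-!
An algorithm that errs rarely must separate the two leading arms even when their means are nearly
equal, and near-ties are not rare under the prior: a gap of at most `w` between the two leading
arms has probability of order `w L(H)`. The scale of the gaps is `D`, defined by
`δ = L(H) D / (32 e⁴)`, and `w = D / 32`.

*Exchanging the leading arms.* Let the means be `x + d` at arm `i`, `x` at arm `j`, with `0 < d ≤ w`
and all other means smaller, and compare with the means obtained by exchanging `i` and `j`. The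
event that the algorithm stops within `n` rounds and recommends `i` depends only on the seed and on
the first `n` rows of the reward table, and the laws of these are products under both vectors of
means. The relation `(∫ f dP)² ≤ K ∫ f² dQ` (`SqDominated`) passes to products and holds for normal
distributions, so the two probabilities of the event satisfy `P² ≤ K P'` (`law_sq_le`), where
`K = exp (n d² / σ_i² + n d² / σ_j²)`; this is at most `2` when `n ≤ a` for
`a = min σ² ln 2 / (2 w²)`. As `i` is wrong under the second vector, the two error probabilities and
the probability of more than `n` rounds add up to at least `1 / 4`
(`Algorithm.quarter_le_poeAt_add`).

*Integration over the prior.* For `|x| ≤ D^(-1/2)` the prior densities at the two vectors are both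
at least `9 / 10` of the weight `h_i(x) h_j(x)`, which is symmetric in `i` and `j`
(`mul_normalDensity_le_normalDensity_add`, `lintegral_pairWeight_mul_le`). The total weight of the
near-ties is `w` times `L(H)` restricted to `|x| ≤ D^(-1/2)`, and the part of `L(H)` lost is at most
`L(H) / 16` (`ofReal_mul_L_le`): beyond that range a prior density is at most `D / (4 ξ_i²)`, which
is the estimate behind the Lambert function in `D₀`. The near-ties of different ordered pairs are
disjoint, whence
`(9 / 40) w (15 / 16) L(H) ≤ 2 PoE + ℙ(τ > n)` (`lintegral_pairWeight_le_poe`).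

*Conclusion.* With `n = ⌊a⌋`, Markov's inequality gives
`ℙ(τ > n) ≤ 𝔼[τ] / (n + 1) ≤ N_V / a = L(H) D / 256` if `𝔼[τ] ≤ N_V`. The left side above is
larger than this by more than `2 L(H) D / 800 ≥ 2 δ`, so `PoE > δ`. The strict inequality yields
both assertions.
-/

namespace BAI

/-! ### Square domination of measures -/

/-- `P` is dominated by `Q` in the sense of the chi-square divergence: `(∫ f dP)² ≤ K ∫ f² dQ` for
all measurable `f ≥ 0`. When `P ≪ Q` the best constant `K` is `∫ (dP/dQ)² dQ = 1 + χ²(P, Q)`; stated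
through test functions, the property passes to products and to image measures with no mention of
densities. -/
def SqDominated {α : Type*} [MeasurableSpace α] (P Q : Measure α) (K : ℝ≥0∞) : Prop :=
  ∀ f : α → ℝ≥0∞, Measurable f → (∫⁻ x, f x ∂P) ^ 2 ≤ K * ∫⁻ x, f x ^ 2 ∂Q

theorem sq_lintegral_mul_le {α : Type*} [MeasurableSpace α] (μ : Measure α) {f g : α → ℝ≥0∞}
    (hf : Measurable f) (hg : Measurable g) :
    (∫⁻ x, f x * g x ∂μ) ^ 2 ≤ (∫⁻ x, f x ^ 2 ∂μ) * ∫⁻ x, g x ^ 2 ∂μ := by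
  have h := ENNReal.lintegral_mul_le_Lp_mul_Lq μ Real.HolderConjugate.two_two
    hf.aemeasurable hg.aemeasurable
  have hs : ∀ x : ℝ≥0∞, (x ^ (1 / 2 : ℝ)) ^ 2 = x := fun x => by
    rw [← ENNReal.rpow_natCast, ← ENNReal.rpow_mul]; norm_num
  calc (∫⁻ x, f x * g x ∂μ) ^ 2
      ≤ ((∫⁻ x, f x ^ (2 : ℝ) ∂μ) ^ (1 / 2 : ℝ) * (∫⁻ x, g x ^ (2 : ℝ) ∂μ) ^ (1 / 2 : ℝ)) ^ 2 := by
        gcongr; simpa using h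
    _ = _ := by rw [mul_pow, hs, hs]; simp

namespace SqDominated

theorem refl {α : Type*} [MeasurableSpace α] (P : Measure α) [IsProbabilityMeasure P] :
    SqDominated P P 1 := fun f hf => by
  simpa [mul_comm] using sq_lintegral_mul_le P hf (measurable_const (a := (1 : ℝ≥0∞)))

theorem map {α β : Type*} [MeasurableSpace α] [MeasurableSpace β] {P Q : Measure α} {K : ℝ≥0∞}
    (h : SqDominated P Q K) {g : α → β} (hg : Measurable g) :
    SqDominated (P.map g) (Q.map g) K := fun f hf => by
  rw [lintegral_map hf hg, lintegral_map (hf.pow_const 2) hg]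
  exact h _ (hf.comp hg)

theorem prod {α β : Type*} [MeasurableSpace α] [MeasurableSpace β] {P Q : Measure α}
    {P' Q' : Measure β} [SFinite P'] [SFinite Q'] {K K' : ℝ≥0∞}
    (h : SqDominated P Q K) (h' : SqDominated P' Q' K') :
    SqDominated (P.prod P') (Q.prod Q') (K * K') := fun f hf => by
  rw [lintegral_prod _ hf.aemeasurable, lintegral_prod _ (hf.pow_const 2).aemeasurable]
  refine (h _ hf.lintegral_prod_right').trans ?_
  rw [mul_assoc, ← lintegral_const_mul _ (hf.pow_const 2).lintegral_prod_right']
  gcongr with x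
  exact h' _ (hf.comp measurable_prodMk_left)

theorem pi {ι : Type*} [Fintype ι] {X : ι → Type*} [∀ i, MeasurableSpace (X i)]
    {P Q : ∀ i, Measure (X i)} [∀ i, SigmaFinite (P i)] [∀ i, SigmaFinite (Q i)] {K : ι → ℝ≥0∞}
    (h : ∀ i, SqDominated (P i) (Q i) (K i)) :
    SqDominated (Measure.pi P) (Measure.pi Q) (∏ i, K i) := fun f hf => by
  classical
  have key : ∀ s : Finset ι, ∀ x,
      (lmarginal P s f x) ^ 2 ≤ (∏ i ∈ s, K i) * lmarginal Q s (fun y => f y ^ 2) x := by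
    intro s
    induction s using Finset.induction with
    | empty => simp
    | insert i s hi ih =>
      intro x
      rw [lmarginal_insert _ hf hi, lmarginal_insert _ (hf.pow_const 2) hi,
        Finset.prod_insert hi, mul_assoc]
      have hm : Measurable fun y => lmarginal P s f (Function.update x i y) :=
        (Measurable.lmarginal P hf).comp (measurable_update x)
      have hm' : Measurable fun y => lmarginal Q s (fun y => f y ^ 2) (Function.update x i y) :=
        (Measurable.lmarginal Q (hf.pow_const 2)).comp (measurable_update x)
      refine (h i _ hm).trans ?_
      rw [← lintegral_const_mul _ hm']
      gcongr with y
      exact ih _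
  rcases isEmpty_or_nonempty (∀ i, X i) with he | ⟨⟨x⟩⟩
  · simp [lintegral_of_isEmpty]
  simpa using key Finset.univ x

theorem measure_sq_le {α : Type*} [MeasurableSpace α] {P Q : Measure α} {K : ℝ≥0∞}
    (h : SqDominated P Q K) {s : Set α} (hs : MeasurableSet s) : P s ^ 2 ≤ K * Q s := by
  have := h (s.indicator 1) (measurable_one.indicator hs)
  have e : ∀ x, (s.indicator (1 : α → ℝ≥0∞) x) ^ 2 = s.indicator 1 x := fun x => by
    by_cases hx : x ∈ s <;> simp [hx]
  simpa [e, lintegral_indicator_one hs] using this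

end SqDominated

/-! ### Normal distributions -/

theorem toNNReal_sq_ne_zero {s : ℝ} (hs : 0 < s) : (s ^ 2).toNNReal ≠ 0 := by
  simpa using hs.ne'

theorem normal_eq_withDensity (c : ℝ) {s : ℝ} (hs : 0 < s) :
    normal c s = volume.withDensity fun x => ENNReal.ofReal (normalDensity c s x) := by
  rw [normal, gaussianReal_of_var_ne_zero _ (toNNReal_sq_ne_zero hs)]; rfl

theorem normalDensity_eq (c s x : ℝ) :
    normalDensity c s x =
      (√(2 * Real.pi * s ^ 2))⁻¹ * Real.exp (-(x - c) ^ 2 / (2 * s ^ 2)) := by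
  rw [normalDensity, gaussianPDFReal, Real.coe_toNNReal _ (sq_nonneg s)]

theorem normalDensity_nonneg (c s x : ℝ) : 0 ≤ normalDensity c s x := gaussianPDFReal_nonneg _ _ _

@[fun_prop]
theorem measurable_normalDensity (c s : ℝ) : Measurable (normalDensity c s) :=
  measurable_gaussianPDFReal _ _

theorem lintegral_normalDensity (c : ℝ) {s : ℝ} (hs : 0 < s) :
    ∫⁻ x, ENNReal.ofReal (normalDensity c s x) = 1 :=
  lintegral_gaussianPDFReal_eq_one c (toNNReal_sq_ne_zero hs)

theorem lintegral_normal (c : ℝ) {s : ℝ} (hs : 0 < s) {f : ℝ → ℝ≥0∞} (hf : Measurable f) :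
    ∫⁻ x, f x ∂normal c s = ∫⁻ x, ENNReal.ofReal (normalDensity c s x) * f x := by
  rw [normal_eq_withDensity c hs, lintegral_withDensity_eq_lintegral_mul _ (by fun_prop) hf]
  rfl

/-- The reason is `φ_a² = exp ((a - b)² / s²) φ_b φ_{2a - b}` for the densities, followed by the
Cauchy–Schwarz inequality. -/
theorem sqDominated_normal (a b : ℝ) {s : ℝ} (hs : 0 < s) :
    SqDominated (normal a s) (normal b s) (ENNReal.ofReal (Real.exp ((a - b) ^ 2 / s ^ 2))) :=
    fun f hf => by
  let K := Real.exp ((a - b) ^ 2 / s ^ 2) 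
  have key : ∀ x, normalDensity a s x =
      √(normalDensity b s x) * √(K * normalDensity (2 * a - b) s x) := fun x => by
    rw [← Real.sqrt_mul (normalDensity_nonneg _ _ _), eq_comm,
      Real.sqrt_eq_iff_mul_self_eq (mul_nonneg (normalDensity_nonneg _ _ _)
        (mul_nonneg (Real.exp_nonneg _) (normalDensity_nonneg _ _ _)))
        (normalDensity_nonneg _ _ _)]
    simp only [normalDensity_eq]
    have : Real.exp (-(x - a) ^ 2 / (2 * s ^ 2)) * Real.exp (-(x - a) ^ 2 / (2 * s ^ 2)) =
        Real.exp (-(x - b) ^ 2 / (2 * s ^ 2)) * (Real.exp ((a - b) ^ 2 / s ^ 2) *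
          Real.exp (-(x - (2 * a - b)) ^ 2 / (2 * s ^ 2))) := by
      simp only [← Real.exp_add]
      congr 1
      field_simp
      ring
    linear_combination -(√(2 * Real.pi * s ^ 2))⁻¹ ^ 2 * this
  have hsq : ∀ y : ℝ, 0 ≤ y → ENNReal.ofReal (√y) ^ 2 = ENNReal.ofReal y := fun y hy => by
    rw [← ENNReal.ofReal_pow (Real.sqrt_nonneg _), Real.sq_sqrt hy]
  rw [lintegral_normal a hs hf, lintegral_normal b hs (hf.pow_const 2)]
  calc (∫⁻ x, ENNReal.ofReal (normalDensity a s x) * f x) ^ 2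
      = (∫⁻ x, (ENNReal.ofReal √(normalDensity b s x) * f x) *
          ENNReal.ofReal √(K * normalDensity (2 * a - b) s x)) ^ 2 := by
        congr 1
        refine lintegral_congr fun x => ?_
        rw [key x, ENNReal.ofReal_mul (Real.sqrt_nonneg _)]
        ring
    _ ≤ _ := sq_lintegral_mul_le _ (by fun_prop) (by fun_prop)
    _ = (∫⁻ x, ENNReal.ofReal (normalDensity b s x) * f x ^ 2) *
          ∫⁻ x, ENNReal.ofReal K * ENNReal.ofReal (normalDensity (2 * a - b) s x) := by
        congr 1
        · refine lintegral_congr fun x => ?_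
          rw [mul_pow, hsq _ (normalDensity_nonneg _ _ _)]
        · refine lintegral_congr fun x => ?_
          rw [hsq _ (mul_nonneg (Real.exp_nonneg _) (normalDensity_nonneg _ _ _)),
            ENNReal.ofReal_mul (Real.exp_nonneg _)]
    _ = _ := by
        rw [lintegral_const_mul _ (by fun_prop), lintegral_normalDensity _ hs, mul_one, mul_comm]

/-! ### Change of measure for the reward table -/

instance {k : ℕ} (σ μ : Fin k → ℝ) : IsProbabilityMeasure (law σ μ) := by
  unfold law; infer_instance

namespace SamplingRule

variable {k : ℕ}

theorem arm_congr (S : SamplingRule k) {ω ω' : Outcome k} (h : ω.1 = ω'.1) (t : ℕ)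
    (ht : ∀ s < t, ω.2 s = ω'.2 s) : S.arm t ω = S.arm t ω' := by
  induction t using Nat.strong_induction_on with
  | _ t ih =>
    have hs : ∀ s : Fin t, S.arm s ω = S.arm s ω' := fun s =>
      ih s s.isLt fun r hr => ht r (hr.trans s.isLt)
    rw [S.arm_eq, S.arm_eq, history, history, h]
    simp only [reward, hs, ht _ (Fin.isLt _)]

/-- After `t` rounds only the seed and the first `t` rows of the reward table have been used. -/
theorem history_congr (S : SamplingRule k) {ω ω' : Outcome k} (h : ω.1 = ω'.1) (t : ℕ)
    (ht : ∀ s < t, ω.2 s = ω'.2 s) : S.history t ω = S.history t ω' := by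
  have hs : ∀ s : Fin t, S.arm s ω = S.arm s ω' := fun s =>
    S.arm_congr h s fun r hr => ht r (hr.trans s.isLt)
  rw [history, history, h]
  simp only [reward, hs, ht _ (Fin.isLt _)]

end SamplingRule

section Table

variable {k : ℕ}

/-- The outcome with a given seed and a given initial segment of the reward table; the remaining
rows are filled with zeros. -/
def padOutcome (k n : ℕ) (p : unitInterval × (Finset.range n → Fin k → ℝ)) : Outcome k :=
  (p.1, fun t => if h : t ∈ Finset.range n then p.2 ⟨t, h⟩ else 0)

theorem measurable_padOutcome (k n : ℕ) : Measurable (padOutcome k n) := by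
  refine measurable_fst.prodMk (measurable_pi_lambda _ fun t => ?_)
  by_cases h : t ∈ Finset.range n
  · simp only [h, dite_true]; fun_prop
  · simp only [h, dite_false]; fun_prop

/-- The law of the seed and the first `n` rows of the reward table. -/
noncomputable def truncatedLaw (n : ℕ) (σ μ : Fin k → ℝ) :
    Measure (unitInterval × (Finset.range n → Fin k → ℝ)) :=
  (volume : Measure unitInterval).prod
    (Measure.pi fun _ => Measure.pi fun i => normal (μ i) (σ i))

theorem map_law_truncate (n : ℕ) (σ μ : Fin k → ℝ) :
    (law σ μ).map (Prod.map id (Finset.range n).restrict) = truncatedLaw n σ μ := by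
  rw [law, ← Measure.map_prod_map _ _ measurable_id (Finset.measurable_restrict _),
    Measure.map_id, Measure.infinitePi_map_restrict, truncatedLaw]

theorem law_apply_of_measurableSet_filtration (S : SamplingRule k) {n : ℕ} {E : Set (Outcome k)}
    (hE : MeasurableSet[S.filtration n] E) (σ μ : Fin k → ℝ) :
    law σ μ E = (truncatedLaw n σ μ).map (padOutcome k n) E := by
  have hE' : MeasurableSet E := S.filtration.le n _ hE
  have hr : Measurable (Prod.map (id : unitInterval → unitInterval)
      ((Finset.range n).restrict (π := fun _ => Fin k → ℝ))) :=
    measurable_id.prodMap (Finset.measurable_restrict _)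
  rw [← map_law_truncate, Measure.map_map (measurable_padOutcome k n) hr,
    Measure.map_apply ((measurable_padOutcome k n).comp hr) hE']
  congr 1
  obtain ⟨B, -, rfl⟩ := hE
  ext ω
  have : S.history n ω = S.history n (padOutcome k n (ω.1, (Finset.range n).restrict ω.2)) :=
    S.history_congr (by rfl) n fun s hs => by simp [padOutcome, hs]
  change S.history n ω ∈ B ↔ S.history n (padOutcome k n (ω.1, (Finset.range n).restrict ω.2)) ∈ B
  rw [this]

/-- Change of measure: an event observable within `n` rounds has comparable probabilities under two
vectors of means. As the first `n` rows of the whole reward table have a product law, no analysis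
of the sampling rule is needed. -/
theorem law_sq_le (S : SamplingRule k) {n : ℕ} {E : Set (Outcome k)}
    (hE : MeasurableSet[S.filtration n] E) {σ : Fin k → ℝ} (hσ : ∀ i, 0 < σ i) (μ μ' : Fin k → ℝ) :
    law σ μ E ^ 2 ≤
      ENNReal.ofReal (Real.exp (n * ∑ i, (μ i - μ' i) ^ 2 / σ i ^ 2)) * law σ μ' E := by
  rw [law_apply_of_measurableSet_filtration S hE, law_apply_of_measurableSet_filtration S hE]
  have h : SqDominated (truncatedLaw n σ μ) (truncatedLaw n σ μ') _ :=
    (SqDominated.refl (volume : Measure unitInterval)).prod <|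
      SqDominated.pi fun _ : Finset.range n => SqDominated.pi fun i =>
        sqDominated_normal (μ i) (μ' i) (hσ i)
  convert (h.map (measurable_padOutcome k n)).measure_sq_le (S.filtration.le n _ hE) using 2
  simp [← ENNReal.ofReal_prod_of_nonneg, Real.exp_nonneg, ← Real.exp_sum, ← ENNReal.ofReal_pow,
    Real.exp_nat_mul]

/-! ### Dependence on the means -/

/-- Adding the vector `μ` to each row of the reward table. -/
def shiftOutcome (μ : Fin k → ℝ) (ω : Outcome k) : Outcome k := (ω.1, fun t i => ω.2 t i + μ i)

theorem measurable_shiftOutcome :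
    Measurable fun p : (Fin k → ℝ) × Outcome k => shiftOutcome p.1 p.2 := by
  unfold shiftOutcome
  fun_prop

theorem law_eq_map_shiftOutcome (σ μ : Fin k → ℝ) : law σ μ = (law σ 0).map (shiftOutcome μ) := by
  have h1 : ∀ i, (normal ((0 : Fin k → ℝ) i) (σ i)).map (· + μ i) = normal (μ i) (σ i) :=
    fun i => by simp [normal, gaussianReal_map_add_const]
  have h2 : (Measure.pi fun i => normal ((0 : Fin k → ℝ) i) (σ i)).map (fun x i => x i + μ i) =
      Measure.pi fun i => normal (μ i) (σ i) := by
    rw [Measure.pi_map_pi (f := fun i x => x + μ i) (fun i => by fun_prop)]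
    simp only [h1]
  have h3 : (Measure.infinitePi fun _ : ℕ =>
      Measure.pi fun i => normal ((0 : Fin k → ℝ) i) (σ i)).map (fun x t i => x t i + μ i) =
      Measure.infinitePi fun _ : ℕ => Measure.pi fun i => normal (μ i) (σ i) := by
    rw [Measure.infinitePi_map_pi (f := fun _ (x : Fin k → ℝ) i => x i + μ i) _
      (fun t => by fun_prop)]
    simp only [h2]
  have h4 : shiftOutcome μ = Prod.map id fun x t i => x t i + μ i := rfl
  rw [h4, law, law, ← Measure.map_prod_map _ _ measurable_id (by fun_prop), Measure.map_id, h3]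

/-- A function of the means and the outcome has a measurable expectation under `ℙ_μ`. -/
theorem measurable_lintegral_law (σ : Fin k → ℝ) {f : (Fin k → ℝ) × Outcome k → ℝ≥0∞}
    (hf : Measurable f) : Measurable fun μ => ∫⁻ ω, f (μ, ω) ∂law σ μ := by
  have h : ∀ μ, ∫⁻ ω, f (μ, ω) ∂law σ μ = ∫⁻ ω, f (μ, shiftOutcome μ ω) ∂law σ 0 := fun μ => by
    have h1 : Measurable fun ω => f (μ, ω) := hf.comp measurable_prodMk_left
    have h2 : Measurable (shiftOutcome μ) := measurable_shiftOutcome.comp measurable_prodMk_left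
    rw [law_eq_map_shiftOutcome σ μ, lintegral_map h1 h2]
  simp only [h]
  exact (hf.comp (measurable_fst.prodMk measurable_shiftOutcome)).lintegral_prod_right'

theorem measurable_law_apply (σ : Fin k → ℝ) {s : Set ((Fin k → ℝ) × Outcome k)}
    (hs : MeasurableSet s) : Measurable fun μ => law σ μ {ω | (μ, ω) ∈ s} := by
  have := measurable_lintegral_law σ (measurable_one.indicator hs)
  convert this using 2 with μ
  exact (lintegral_indicator_one (measurable_prodMk_left hs)).symm

end Table

/-! ### Error probability and sample size under fixed means -/

namespace Algorithm

variable {k : ℕ} (π : Algorithm k)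

theorem measurableSet_J_inter (i : Fin k) (n : ℕ) :
    MeasurableSet[π.filtration n] {ω | π.J ω = i ∧ π.τ ω ≤ n} :=
  (π.measurable_J (measurableSet_singleton i)).2 n

theorem measurable_J' : Measurable π.J :=
  π.measurable_J.mono π.isStoppingTime_τ.measurableSpace_le le_rfl

theorem measurableSet_lt_τ (n : ℕ) : MeasurableSet {ω | (n : ℕ∞) < π.τ ω} := by
  have h : MeasurableSet {ω | π.τ ω ≤ (n : ℕ∞)} :=
    π.filtration.le n _ (π.isStoppingTime_τ n)
  simpa [Set.compl_ofPred, not_le] using h.compl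

theorem measurable_poeAt (σ : Fin k → ℝ) : Measurable (π.poeAt σ) := by
  refine measurable_law_apply σ (s := {p | ¬ ∀ j, p.1 j ≤ p.1 (π.J p.2)}) ?_
  have e : Measurable fun p : (Fin k → ℝ) × Fin k => p.1 p.2 :=
    measurable_from_prod_countable_left fun i => measurable_pi_apply i
  have h : MeasurableSet {p : (Fin k → ℝ) × Outcome k | ∀ j, p.1 j ≤ p.1 (π.J p.2)} := by
    simp only [Set.ofPred_forall]
    exact MeasurableSet.iInter fun j => measurableSet_le (by fun_prop)
      (e.comp (measurable_fst.prodMk (π.measurable_J'.comp measurable_snd)))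
  exact h.compl

/-- The probability under `ℙ_μ` that more than `n` samples are taken. -/
noncomputable def tailAt (σ : Fin k → ℝ) (n : ℕ) (μ : Fin k → ℝ) : ℝ≥0∞ :=
  law σ μ {ω | (n : ℕ∞) < π.τ ω}

theorem measurable_tailAt (σ : Fin k → ℝ) (n : ℕ) : Measurable (π.tailAt σ n) :=
  measurable_law_apply σ (s := {p | (n : ℕ∞) < π.τ p.2}) (measurable_snd (π.measurableSet_lt_τ n))

/-- Markov's inequality for the integer-valued `τ`, where `τ > n` means `τ ≥ n + 1`. -/
theorem succ_mul_lintegral_tailAt_le (m ξ σ : Fin k → ℝ) (n : ℕ) :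
    (n + 1) * ∫⁻ μ, π.tailAt σ n μ ∂prior m ξ ≤ π.expectedTime m ξ σ := by
  rw [expectedTime, ← lintegral_const_mul _ (π.measurable_tailAt σ n)]
  refine lintegral_mono fun μ => ?_
  rw [tailAt, ← setLIntegral_const]
  refine (setLIntegral_mono' (π.measurableSet_lt_τ n) fun ω hω => ?_).trans
    (setLIntegral_le_lintegral _ _)
  have : ((n + 1 : ℕ) : ℕ∞) ≤ π.τ ω := by
    push_cast; exact Order.add_one_le_of_lt hω
  have := ENat.toENNReal_le.2 this
  simpa using this

/-- If `μ` has the unique best arm `i`, `μ'` has the unique best arm `j`, and their laws are close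
over `n` rounds, then the algorithm errs under one of them unless it runs for more than `n`
rounds. -/
theorem quarter_le_poeAt_add {σ : Fin k → ℝ} (hσ : ∀ i, 0 < σ i) {n : ℕ} {μ μ' : Fin k → ℝ}
    {i j : Fin k} (hij : i ≠ j) (hi : ∀ s, s ≠ i → μ s < μ i) (hj : ∀ s, s ≠ j → μ' s < μ' j)
    (hK : n * ∑ i, (μ i - μ' i) ^ 2 / σ i ^ 2 ≤ Real.log 2) :
    (1 / 4 : ℝ≥0∞) ≤ π.poeAt σ μ + π.poeAt σ μ' + π.tailAt σ n μ := by
  set E : Set (Outcome k) := {ω | π.J ω = i ∧ π.τ ω ≤ n} with hEdef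
  have hE := π.measurableSet_J_inter i n
  have h2 : law σ μ E ^ 2 ≤ 2 * law σ μ' E := by
    refine (law_sq_le _ hE hσ μ μ').trans ?_
    gcongr
    rw [← ENNReal.ofReal_ofNat 2]
    refine ENNReal.ofReal_le_ofReal ?_
    rwa [← Real.le_log_iff_exp_le two_pos]
  have h3 : law σ μ' E ≤ π.poeAt σ μ' := by
    refine measure_mono fun ω hω h => ?_
    have := h j
    rw [hω.1] at this
    exact absurd (hj i hij) (not_lt.2 this)
  have h4 : 1 ≤ law σ μ E + (π.poeAt σ μ + π.tailAt σ n μ) := by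
    rw [← measure_univ (μ := law σ μ)]
    refine (measure_mono fun ω _ => ?_).trans
      ((measure_union_le E _).trans (by gcongr; exact measure_union_le _ _))
    by_cases hτ : π.τ ω ≤ n
    · by_cases hJ : π.J ω = i
      · exact Or.inl ⟨hJ, hτ⟩
      · exact Or.inr (Or.inl fun h => absurd (hi _ hJ) (not_lt.2 (h i)))
    · exact Or.inr (Or.inr (not_le.1 hτ))
  have h5 : law σ μ E ^ 2 ≤ 2 * π.poeAt σ μ' := h2.trans (by gcongr)
  have t1 : law σ μ E ≠ ∞ := measure_ne_top _ _
  have t2 : π.poeAt σ μ ≠ ∞ := measure_ne_top _ _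
  have t3 : π.poeAt σ μ' ≠ ∞ := measure_ne_top _ _
  have t4 : π.tailAt σ n μ ≠ ∞ := measure_ne_top _ _
  lift law σ μ E to NNReal using t1 with e
  lift π.poeAt σ μ to NNReal using t2 with a
  lift π.poeAt σ μ' to NNReal using t3 with b
  lift π.tailAt σ n μ to NNReal using t4 with u
  have e4 : (1 / 4 : ℝ≥0∞) = ((1 / 4 : NNReal) : ℝ≥0∞) := by
    rw [ENNReal.coe_div (by norm_num)]; norm_num
  rw [e4]
  norm_cast at h4 h5 ⊢
  rw [← NNReal.coe_le_coe] at h4 h5 ⊢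
  push_cast at h4 h5 ⊢
  by_contra! hc
  have := b.coe_nonneg
  nlinarith [a.coe_nonneg, u.coe_nonneg]

end Algorithm

/-! ### The Lambert function and `D₀` -/

theorem lambertLower_spec {x : ℝ} (hx : -Real.exp (-1) ≤ x) (hx0 : x < 0) :
    lambertLower x ≤ -1 ∧ lambertLower x * Real.exp (lambertLower x) = x := by
  have hc : Continuous fun w : ℝ => w * Real.exp w := by fun_prop
  have hlim : Filter.Tendsto (fun w : ℝ => w * Real.exp w) Filter.atBot (nhds 0) := by
    have := (Real.tendsto_pow_mul_exp_neg_atTop_nhds_zero 1).comp Filter.tendsto_neg_atBot_atTop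
    simpa [Function.comp_def] using this.neg
  obtain ⟨b, hb1, hb⟩ : ∃ b : ℝ, b ≤ -1 ∧ x < b * Real.exp b :=
    ((Filter.eventually_le_atBot (-1)).and (hlim.eventually (lt_mem_nhds hx0))).exists
  have hne : {w : ℝ | w ≤ -1 ∧ w * Real.exp w = x}.Nonempty := by
    obtain ⟨w, hw, hwx⟩ := intermediate_value_Icc' hb1 hc.continuousOn
      (show x ∈ Set.Icc (-1 * Real.exp (-1)) (b * Real.exp b) from ⟨by linarith, hb.le⟩)
    exact ⟨w, hw.2, hwx⟩
  have hcl : IsClosed {w : ℝ | w ≤ -1 ∧ w * Real.exp w = x} :=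
    (isClosed_le continuous_id continuous_const).inter (isClosed_eq hc continuous_const)
  exact hcl.csSup_mem hne ⟨-1, fun w hw => hw.1⟩

theorem mul_exp_neg_le_of_le {w t : ℝ} (hw : 1 ≤ w) (hwt : w ≤ t) :
    t * Real.exp (-t) ≤ w * Real.exp (-w) := by
  have h : t ≤ w * Real.exp (t - w) := by
    have := Real.add_one_le_exp (t - w)
    nlinarith
  calc t * Real.exp (-t) ≤ w * Real.exp (t - w) * Real.exp (-t) := by gcongr
    _ = w * Real.exp (-w) := by rw [mul_assoc, ← Real.exp_add]; ring_nf

/-- The purpose of the Lambert function in `D₀`: it solves `exp (-t) ≤ D / (2 ξ_max)` for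
`t = 1 / (16 ξ_max² D)`. The crude bound `D ≤ 1` also holds below `D₀`. -/
theorem exp_neg_le_of_lt_D0 {k : ℕ} {ξ : Fin k → ℝ} (hX : 0 < ⨆ i, ξ i) {D : ℝ} (hD : 0 < D)
    (hD0 : D < D0 ξ) :
    Real.exp (-(1 / (16 * (⨆ i, ξ i) ^ 2 * D))) ≤ D / (2 * ⨆ i, ξ i) ∧ D ≤ 1 := by
  set X := ⨆ i, ξ i
  set t := 1 / (16 * X ^ 2 * D) with ht
  -- It suffices to bound `t * exp (-t)`.
  suffices h : t * Real.exp (-t) ≤ 1 / (32 * X ^ 3) ∧ D ≤ 1 by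
    refine ⟨?_, h.2⟩
    calc Real.exp (-t) = (16 * X ^ 2 * D) * (t * Real.exp (-t)) := by rw [ht]; field_simp
      _ ≤ (16 * X ^ 2 * D) * (1 / (32 * X ^ 3)) := by gcongr; exact h.1
      _ = D / (2 * X) := by field_simp; norm_num
  unfold D0 at hD0
  split_ifs at hD0 with hX3
  · change D < 1 / (16 * X ^ 2 * |lambertLower (-(1 / (32 * X ^ 3)))|) at hD0
    have hX3' : Real.exp 1 < 32 * X ^ 3 := by
      change Real.exp 1 / 32 < X ^ 3 at hX3
      linarith
    obtain ⟨h1, h2⟩ := lambertLower_spec (x := -(1 / (32 * X ^ 3)))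
      (by rw [Real.exp_neg, ← one_div]; gcongr) (by rw [neg_lt_zero]; positivity)
    set W := lambertLower (-(1 / (32 * X ^ 3)))
    rw [abs_of_nonpos (by linarith), lt_div_iff₀ (by nlinarith [sq_nonneg X, pow_pos hX 2])] at hD0
    have hWt : -W ≤ t := by
      rw [ht, le_div_iff₀ (by positivity)]
      nlinarith
    have hX4 : 1 / 4 < X := by
      by_contra! hc
      have : X ^ 3 ≤ (1 / 4) ^ 3 := by gcongr
      have := Real.add_one_le_exp 1
      linarith
    constructor
    · refine (mul_exp_neg_le_of_le (by linarith) hWt).trans ?_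
      rw [neg_neg]
      linarith
    · have h16 : 1 ≤ 16 * X ^ 2 := by nlinarith
      have : 1 ≤ 16 * X ^ 2 * -W := by nlinarith
      nlinarith
  · refine ⟨?_, hD0.le⟩
    have hX3' : 32 * X ^ 3 ≤ Real.exp 1 := by
      have : X ^ 3 ≤ Real.exp 1 / 32 := not_lt.1 hX3
      linarith
    calc t * Real.exp (-t) ≤ Real.exp (-1) := by
          have := Real.add_one_le_exp (t - 1)
          calc t * Real.exp (-t) ≤ Real.exp (t - 1) * Real.exp (-t) := by gcongr; linarith
            _ = Real.exp (-1) := by rw [← Real.exp_add]; ring_nf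
      _ = 1 / Real.exp 1 := by rw [Real.exp_neg, one_div]
      _ ≤ 1 / (32 * X ^ 3) := by gcongr

/-! ### Estimates for the prior densities -/

/-- At points of size at most `1 / r`, a shift by `d ≤ r² / 32` decreases the normal density by at
most ten percent, as soon as `r` is small compared with the parameters. -/
theorem mul_normalDensity_le_normalDensity_add {c s r x d : ℝ} (hr : 0 < r) (hr1 : r ≤ 1)
    (hc : |c| * r ≤ 1 / 2) (hs : r * (1 / (2 * s ^ 2)) ≤ 1) (hx : |x| * r ≤ 1)
    (hd : 0 ≤ d) (hd' : d ≤ r ^ 2 / 32) :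
    9 / 10 * normalDensity c s x ≤ normalDensity c s (x + d) := by
  rw [normalDensity_eq, normalDensity_eq]
  set q := 1 / (2 * s ^ 2) with hq
  have hq0 : 0 ≤ q := by positivity
  have e : -(x + d - c) ^ 2 / (2 * s ^ 2) =
      -(x - c) ^ 2 / (2 * s ^ 2) + -(2 * d * (x - c) * q + d ^ 2 * q) := by
    rw [hq]; ring
  have h1 : d * (x - c) * q ≤ 3 / 64 := by
    have hxc : (x - c) * r ≤ 3 / 2 := by
      have := le_abs_self x
      have := neg_abs_le c
      nlinarith
    calc d * (x - c) * q = (d * q) * (x - c) := by ring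
      _ ≤ (d * q) * (3 / 2 / r) := by
          gcongr
          rw [le_div_iff₀ hr]; exact hxc
      _ ≤ (r ^ 2 / 32 * q) * (3 / 2 / r) := by gcongr
      _ = (r * q) * (3 / 64) := by field_simp; ring
      _ ≤ 1 * (3 / 64) := by gcongr
      _ = 3 / 64 := by ring
  have h2 : d ^ 2 * q ≤ 1 / 1024 := by
    calc d ^ 2 * q ≤ (r ^ 2 / 32) ^ 2 * q := by gcongr
      _ = r ^ 3 * (r * q) / 1024 := by ring
      _ ≤ 1 ^ 3 * 1 / 1024 := by gcongr
      _ = 1 / 1024 := by ring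
  have h3 : (9 / 10 : ℝ) ≤ Real.exp (-(2 * d * (x - c) * q + d ^ 2 * q)) := by
    have := Real.add_one_le_exp (-(2 * d * (x - c) * q + d ^ 2 * q))
    linarith
  rw [e, Real.exp_add]
  have : 0 ≤ (√(2 * Real.pi * s ^ 2))⁻¹ * Real.exp (-(x - c) ^ 2 / (2 * s ^ 2)) := by positivity
  nlinarith

/-- At points of size at least `1 / r` the density is `O(r² / s²)`, with no exponential left:
this is what makes the tail of `L(H)` comparable with `∑ 1 / ξ_i²`. Here `X` stands for the largest
prior standard deviation. -/
theorem normalDensity_le_of_le_abs {c s X r x : ℝ} (hr : 0 < r) (hs : 0 < s) (hsX : s ≤ X)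
    (hc : |c| * r ≤ 1 / 2) (hx : 1 ≤ |x| * r)
    (hX : Real.exp (-(1 / (16 * X ^ 2 * r ^ 2))) ≤ r ^ 2 / (2 * X)) :
    normalDensity c s x ≤ r ^ 2 / 4 * (1 / s ^ 2) := by
  have hX0 : 0 < X := hs.trans_le hsX
  have h1 : (√(2 * Real.pi * s ^ 2))⁻¹ ≤ (2 * s)⁻¹ := by
    gcongr
    refine Real.le_sqrt_of_sq_le ?_
    nlinarith [Real.pi_gt_three, pow_pos hs 2]
  have h2 : 1 / 2 ≤ |x - c| * r := by
    have := abs_sub_abs_le_abs_sub x c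
    nlinarith
  have h3 : -(x - c) ^ 2 / (2 * s ^ 2) ≤ -(1 / (16 * X ^ 2 * r ^ 2)) := by
    rw [neg_div, neg_le_neg_iff, div_le_div_iff₀ (by positivity) (by positivity), ← sq_abs (x - c)]
    have h4 : (1 / 2) ^ 2 ≤ (|x - c| * r) ^ 2 := by gcongr
    have h5 : s ^ 2 ≤ X ^ 2 := by gcongr
    nlinarith [mul_nonneg (sq_nonneg X) (sub_nonneg.2 h4), pow_pos hs 2]
  rw [normalDensity_eq]
  calc _ ≤ (2 * s)⁻¹ * Real.exp (-(1 / (16 * X ^ 2 * r ^ 2))) := by gcongr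
    _ ≤ (2 * s)⁻¹ * (r ^ 2 / (2 * s)) := by
        gcongr
        exact hX.trans (by gcongr)
    _ = r ^ 2 / 4 * (1 / s ^ 2) := by field_simp; norm_num

/-! ### Near-ties and the constant `L(H)` -/

variable {k : ℕ}

/-- The integrand `h_i h_j ∏_{s ≠ i, j} H_s` of `L_{ij}`: the density at `x` of the event that arms
`i` and `j` both have mean `x` and the other arms are worse. -/
noncomputable def tieDensity (m ξ : Fin k → ℝ) (i j : Fin k) (x : ℝ) : ℝ≥0∞ :=
  ENNReal.ofReal (normalDensity (m i) (ξ i) x * normalDensity (m j) (ξ j) x) *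
    ∏ s ∈ Finset.univ \ {i, j}, normal (m s) (ξ s) (Set.Iic x)

theorem ofReal_cdf_normal (c s x : ℝ) :
    ENNReal.ofReal (cdf (normal c s) x) = normal c s (Set.Iic x) := ofReal_cdf _ _

theorem ofReal_Lpair_le (m ξ : Fin k → ℝ) (i j : Fin k) :
    ENNReal.ofReal (Lpair m ξ i j) ≤ ∫⁻ x, tieDensity m ξ i j x := by
  have h : ∀ x, tieDensity m ξ i j x = ENNReal.ofReal (normalDensity (m i) (ξ i) x *
      normalDensity (m j) (ξ j) x * ∏ s ∈ Finset.univ \ {i, j}, cdf (normal (m s) (ξ s)) x) :=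
    fun x => by
      rw [ENNReal.ofReal_mul (mul_nonneg (normalDensity_nonneg _ _ _) (normalDensity_nonneg _ _ _)),
        ENNReal.ofReal_prod_of_nonneg fun s _ => cdf_nonneg _ _]
      simp only [ofReal_cdf_normal, tieDensity]
  simp only [h]
  rw [Lpair, integral_eq_lintegral_of_nonneg_ae]
  · exact ENNReal.ofReal_toReal_le
  · refine Filter.Eventually.of_forall fun x => mul_nonneg
      (mul_nonneg (normalDensity_nonneg _ _ _) (normalDensity_nonneg _ _ _))
      (Finset.prod_nonneg fun s _ => cdf_nonneg _ _)
  · have hc : ∀ s, Measurable fun x => cdf (normal (m s) (ξ s)) x := fun s =>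
      (monotone_cdf _).measurable
    have : Measurable fun x => ∏ s ∈ Finset.univ \ {i, j}, cdf (normal (m s) (ξ s)) x :=
      Finset.measurable_fun_prod _ fun s _ => hc s
    exact (((measurable_normalDensity _ _).mul (measurable_normalDensity _ _)).mul
      this).aestronglyMeasurable

/-- Near-ties at a level of size at most `1 / r` carry most of `L(H)`. -/
theorem ofReal_mul_L_le (hk : 2 ≤ k) {m ξ : Fin k → ℝ} (hξ : ∀ i, 0 < ξ i) {r : ℝ} (hr : 0 < r)
    (hm : ∀ i, |m i| * r ≤ 1 / 2)
    (hX : Real.exp (-(1 / (16 * (⨆ i, ξ i) ^ 2 * r ^ 2))) ≤ r ^ 2 / (2 * ⨆ i, ξ i))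
    (hL : r ^ 2 ≤ L m ξ / (4 * ((k : ℝ) - 1) * ∑ i, 1 / ξ i ^ 2)) :
    ENNReal.ofReal (15 / 16 * L m ξ) ≤
      ∑ p ∈ (Finset.univ : Finset (Fin k)).offDiag,
        ∫⁻ x in Set.Icc (-(1 / r)) (1 / r), tieDensity m ξ p.1 p.2 x := by
  have hoff : ∀ {M : Type} [AddCommMonoid M] (f : Fin k → Fin k → M),
      ∑ p ∈ (Finset.univ : Finset (Fin k)).offDiag, f p.1 p.2 =
        ∑ i, ∑ j ∈ Finset.univ.erase i, f i j := fun f =>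
    Finset.sum_finset_product' _ _ _ fun p => by simp [ne_comm]
  have hk1 : (1 : ℝ) ≤ k - 1 := by
    have : (2 : ℝ) ≤ k := by exact_mod_cast hk
    linarith
  have hS : 0 < ∑ i, 1 / ξ i ^ 2 :=
    Finset.sum_pos (fun i _ => by have := hξ i; positivity) ⟨⟨0, by omega⟩, Finset.mem_univ _⟩
  have hL' : r ^ 2 * (4 * ((k : ℝ) - 1) * ∑ i, 1 / ξ i ^ 2) ≤ L m ξ := by
    rwa [le_div_iff₀ (by positivity)] at hL
  have htail : ∀ i j, ∫⁻ x in (Set.Icc (-(1 / r)) (1 / r))ᶜ, tieDensity m ξ i j x ≤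
      ENNReal.ofReal (r ^ 2 / 4 * (1 / ξ i ^ 2)) := fun i j => by
    calc ∫⁻ x in (Set.Icc (-(1 / r)) (1 / r))ᶜ, tieDensity m ξ i j x
        ≤ ∫⁻ x in (Set.Icc (-(1 / r)) (1 / r))ᶜ, ENNReal.ofReal (r ^ 2 / 4 * (1 / ξ i ^ 2)) *
            ENNReal.ofReal (normalDensity (m j) (ξ j) x) := by
          refine setLIntegral_mono' measurableSet_Icc.compl fun x hx => ?_
          have hx' : 1 ≤ |x| * r := by
            rw [Set.mem_compl_iff, Set.mem_Icc, ← abs_le, not_le, div_lt_iff₀ hr] at hx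
            exact hx.le
          have hprod : ∏ s ∈ Finset.univ \ {i, j}, normal (m s) (ξ s) (Set.Iic x) ≤ 1 :=
            Finset.prod_le_one' fun s _ => prob_le_one
          refine (mul_le_of_le_one_right' hprod).trans ?_
          rw [← ENNReal.ofReal_mul (by positivity)]
          refine ENNReal.ofReal_le_ofReal
            (mul_le_mul_of_nonneg_right ?_ (normalDensity_nonneg _ _ _))
          exact normalDensity_le_of_le_abs hr (hξ i)
            (le_ciSup (Set.finite_range ξ).bddAbove i) (hm i) hx' hX
      _ ≤ ∫⁻ x, ENNReal.ofReal (r ^ 2 / 4 * (1 / ξ i ^ 2)) *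
            ENNReal.ofReal (normalDensity (m j) (ξ j) x) := setLIntegral_le_lintegral _ _
      _ = _ := by
          rw [lintegral_const_mul _ (by fun_prop), lintegral_normalDensity _ (hξ j), mul_one]
  have hsum : ∑ p ∈ (Finset.univ : Finset (Fin k)).offDiag,
      ENNReal.ofReal (r ^ 2 / 4 * (1 / ξ p.1 ^ 2)) ≤ ENNReal.ofReal (1 / 16 * L m ξ) := by
    rw [← ENNReal.ofReal_sum_of_nonneg fun p _ => by positivity]
    refine ENNReal.ofReal_le_ofReal ?_
    rw [hoff fun i _ => r ^ 2 / 4 * (1 / ξ i ^ 2)]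
    have hcard : ∀ i : Fin k, ((Finset.univ.erase i).card : ℝ) = k - 1 := fun i => by
      rw [Finset.card_erase_of_mem (Finset.mem_univ i), Finset.card_univ, Fintype.card_fin,
        Nat.cast_sub (by omega), Nat.cast_one]
    simp only [Finset.sum_const, nsmul_eq_mul, hcard, ← Finset.mul_sum]
    linarith
  have hmain : ENNReal.ofReal (L m ξ) ≤
      (∑ p ∈ (Finset.univ : Finset (Fin k)).offDiag,
        ∫⁻ x in Set.Icc (-(1 / r)) (1 / r), tieDensity m ξ p.1 p.2 x) +
      ENNReal.ofReal (1 / 16 * L m ξ) := by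
    calc ENNReal.ofReal (L m ξ)
        ≤ ∑ p ∈ (Finset.univ : Finset (Fin k)).offDiag, ENNReal.ofReal (Lpair m ξ p.1 p.2) := by
          rw [L, ← hoff]
          exact Finset.le_sum_of_subadditive _ ENNReal.ofReal_zero.le
            (fun _ _ => ENNReal.ofReal_add_le) _ _
      _ ≤ ∑ p ∈ (Finset.univ : Finset (Fin k)).offDiag,
          ((∫⁻ x in Set.Icc (-(1 / r)) (1 / r), tieDensity m ξ p.1 p.2 x) +
            ENNReal.ofReal (r ^ 2 / 4 * (1 / ξ p.1 ^ 2))) := by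
          gcongr with p
          refine (ofReal_Lpair_le m ξ p.1 p.2).trans ?_
          rw [← lintegral_add_compl _ (measurableSet_Icc (a := -(1 / r)) (b := 1 / r))]
          gcongr
          exact htail _ _
      _ ≤ _ := by
          rw [Finset.sum_add_distrib]
          gcongr
  have h0 : 0 ≤ L m ξ := le_trans (by positivity) hL'
  rw [show 15 / 16 * L m ξ = L m ξ - 1 / 16 * L m ξ by ring,
    ENNReal.ofReal_sub _ (by positivity)]
  exact tsub_le_iff_right.2 hmain

/-! ### Resampling a coordinate -/

/-- Resampling one coordinate does not change a product of probability measures. -/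
theorem lintegral_pi_eq_lintegral_update {ι : Type*} [Fintype ι] [DecidableEq ι] {X : ι → Type*}
    [∀ i, MeasurableSpace (X i)] (P : ∀ i, Measure (X i)) [∀ i, IsProbabilityMeasure (P i)] (i : ι)
    {f : (∀ i, X i) → ℝ≥0∞} (hf : Measurable f) :
    ∫⁻ z, f z ∂Measure.pi P = ∫⁻ z, ∫⁻ u, f (Function.update z i u) ∂P i ∂Measure.pi P := by
  have hg : Measurable fun z => ∫⁻ u, f (Function.update z i u) ∂P i := by
    have := Measurable.lmarginal P (s := {i}) hf
    rwa [lmarginal_singleton] at this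
  refine lintegral_eq_of_lmarginal_eq {i} hf hg ?_
  simp [lmarginal_singleton]

/-! ### Near-ties under the prior -/

/-- Arm `i` is the best, arm `j` the second best, their gap is at most `w`, and the mean of arm `j`
has absolute value at most `R`. -/
def nearTie (R w : ℝ) (i j : Fin k) : Set (Fin k → ℝ) :=
  {μ | (∀ s, s ≠ i → s ≠ j → μ s < μ j) ∧ μ j ∈ Set.Icc (-R) R ∧ μ i - μ j ∈ Set.Ioc 0 w}

theorem measurableSet_nearTie (R w : ℝ) (i j : Fin k) : MeasurableSet (nearTie R w i j) := by
  have h1 : MeasurableSet {μ : Fin k → ℝ | ∀ s, s ≠ i → s ≠ j → μ s < μ j} := by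
    simp only [Set.ofPred_forall]
    exact MeasurableSet.iInter fun s => MeasurableSet.iInter fun _ => MeasurableSet.iInter fun _ =>
      measurableSet_lt (by fun_prop) (by fun_prop)
  exact h1.inter (((measurable_pi_apply j) measurableSet_Icc).inter
    (((measurable_pi_apply i).sub (measurable_pi_apply j)) measurableSet_Ioc))

theorem lt_of_mem_nearTie {R w : ℝ} {i j : Fin k} {μ : Fin k → ℝ} (h : μ ∈ nearTie R w i j)
    {s : Fin k} (hs : s ≠ i) : μ s < μ i := by
  have h0 : μ j < μ i := sub_pos.1 h.2.2.1
  by_cases hj : s = j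
  · rwa [hj]
  · exact (h.1 s hs hj).trans h0

theorem pairwiseDisjoint_nearTie (R w : ℝ) :
    ((Finset.univ : Finset (Fin k)).offDiag : Set (Fin k × Fin k)).PairwiseDisjoint
      fun p => nearTie R w p.1 p.2 := by
  rintro ⟨i, j⟩ hp ⟨i', j'⟩ hp' hne
  have hij : i ≠ j := by simpa using hp
  have hij' : i' ≠ j' := by simpa using hp'
  refine Set.disjoint_left.2 fun μ h h' => ?_
  have hii : i = i' := by
    by_contra hc
    exact lt_asymm (lt_of_mem_nearTie h (Ne.symm hc)) (lt_of_mem_nearTie h' hc)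
  subst hii
  have hjj : j ≠ j' := fun hc => hne (by rw [hc])
  exact lt_asymm (h.1 j' hij'.symm hjj.symm) (h'.1 j hij.symm hjj)

theorem sum_setLIntegral_nearTie_le (R w : ℝ) (P : Measure (Fin k → ℝ))
    (f : (Fin k → ℝ) → ℝ≥0∞) :
    ∑ p ∈ (Finset.univ : Finset (Fin k)).offDiag, ∫⁻ μ in nearTie R w p.1 p.2, f μ ∂P ≤
      ∫⁻ μ, f μ ∂P := by
  rw [← lintegral_biUnion_finset (pairwiseDisjoint_nearTie R w)
    fun p _ => measurableSet_nearTie R w p.1 p.2]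
  exact setLIntegral_le_lintegral _ _

/-- The vector with value `x` at `j`, value `x + d` at `i`, and the values of `z` elsewhere, for
`p = (z, x, d)`. Exchanging `i` and `j` exchanges the two leading arms. -/
def placePair (i j : Fin k) (p : (Fin k → ℝ) × ℝ × ℝ) : Fin k → ℝ :=
  Function.update (Function.update p.1 j p.2.1) i (p.2.1 + p.2.2)

theorem placePair_apply (i j : Fin k) (p : (Fin k → ℝ) × ℝ × ℝ) (s : Fin k) :
    placePair i j p s = if s = i then p.2.1 + p.2.2 else if s = j then p.2.1 else p.1 s := by
  simp [placePair, Function.update_apply]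

theorem measurable_placePair (i j : Fin k) : Measurable (placePair i j) := by
  refine measurable_pi_lambda _ fun s => ?_
  simp only [placePair_apply]
  split_ifs <;> fun_prop

/-- The reference measure for `(z, x, d)`: `z` follows the prior, `x` and `d` follow
Lebesgue measure on `[-R, R]` and on `(0, w]`. -/
noncomputable def pairMeasure (m ξ : Fin k → ℝ) (R w : ℝ) : Measure ((Fin k → ℝ) × ℝ × ℝ) :=
  (prior m ξ).prod
    ((volume.restrict (Set.Icc (-R) R)).prod (volume.restrict (Set.Ioc 0 w)))

/-- The weight of `(z, x, d)`, which does not change when `i` and `j` are exchanged. -/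
noncomputable def pairWeight (m ξ : Fin k → ℝ) (i j : Fin k) (p : (Fin k → ℝ) × ℝ × ℝ) : ℝ≥0∞ :=
  {p : (Fin k → ℝ) × ℝ × ℝ | ∀ s, s ≠ i → s ≠ j → p.1 s < p.2.1}.indicator
    (fun p => ENNReal.ofReal (normalDensity (m i) (ξ i) p.2.1 * normalDensity (m j) (ξ j) p.2.1)) p

theorem pairWeight_of_forall_lt (m ξ : Fin k → ℝ) {i j : Fin k} {p : (Fin k → ℝ) × ℝ × ℝ}
    (h : ∀ s, s ≠ i → s ≠ j → p.1 s < p.2.1) : pairWeight m ξ i j p =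
      ENNReal.ofReal (normalDensity (m i) (ξ i) p.2.1 * normalDensity (m j) (ξ j) p.2.1) := by
  rw [pairWeight, Set.indicator_of_mem]
  exact h

theorem pairWeight_of_not_forall_lt (m ξ : Fin k → ℝ) {i j : Fin k} {p : (Fin k → ℝ) × ℝ × ℝ}
    (h : ¬∀ s, s ≠ i → s ≠ j → p.1 s < p.2.1) : pairWeight m ξ i j p = 0 := by
  rw [pairWeight, Set.indicator_of_notMem]
  exact h

theorem pairWeight_comm (m ξ : Fin k → ℝ) (i j : Fin k) :
    pairWeight m ξ i j = pairWeight m ξ j i := by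
  ext p
  simp only [pairWeight, mul_comm (normalDensity (m i) _ _)]
  congr 2
  ext
  exact forall_congr' fun s => forall_comm

theorem measurable_pairWeight (m ξ : Fin k → ℝ) (i j : Fin k) :
    Measurable (pairWeight m ξ i j) := by
  refine Measurable.indicator (by fun_prop) ?_
  simp only [Set.ofPred_forall]
  exact MeasurableSet.iInter fun s => MeasurableSet.iInter fun _ => MeasurableSet.iInter fun _ =>
    measurableSet_lt (by fun_prop) (by fun_prop)

instance (m ξ : Fin k → ℝ) : IsProbabilityMeasure (prior m ξ) := by
  unfold prior; infer_instance

theorem measurable_tieDensity (m ξ : Fin k → ℝ) (i j : Fin k) :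
    Measurable (tieDensity m ξ i j) := by
  have h : ∀ s, Measurable fun x => normal (m s) (ξ s) (Set.Iic x) := fun s =>
    Monotone.measurable fun x y hxy => measure_mono (Set.Iic_subset_Iic.2 hxy)
  unfold tieDensity
  fun_prop

/-- The total weight of the near-ties of the pair `i, j`. -/
theorem lintegral_pairWeight {m ξ : Fin k → ℝ} (hξ : ∀ i, 0 < ξ i) (R w : ℝ) {i j : Fin k} :
    ∫⁻ p, pairWeight m ξ i j p ∂pairMeasure m ξ R w =
      ENNReal.ofReal w * ∫⁻ x in Set.Icc (-R) R, tieDensity m ξ i j x := by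
  have hz : ∀ x d, ∫⁻ z, pairWeight m ξ i j (z, x, d) ∂prior m ξ = tieDensity m ξ i j x := by
    intro x d
    set T : Fin k → Set ℝ := fun s => if s = i ∨ s = j then Set.univ else Set.Iio x with hT
    have hTm : ∀ s, MeasurableSet (T s) := fun s => by
      simp only [hT]; split_ifs <;> simp [measurableSet_Iio]
    have e : ∀ z, pairWeight m ξ i j (z, x, d) = (Set.univ.pi T).indicator
        (fun _ => ENNReal.ofReal
          (normalDensity (m i) (ξ i) x * normalDensity (m j) (ξ j) x)) z := fun z => by
      have : (∀ s, s ≠ i → s ≠ j → z s < x) ↔ z ∈ Set.univ.pi T := by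
        simp only [Set.mem_univ_pi, hT]
        refine forall_congr' fun s => ?_
        by_cases h : s = i ∨ s = j
        · simp only [h, if_true, Set.mem_univ, iff_true]
          intro h1 h2
          exact absurd h (not_or.2 ⟨h1, h2⟩)
        · simp only [h, if_false, Set.mem_Iio]
          exact ⟨fun H => H (not_or.1 h).1 (not_or.1 h).2, fun H _ _ => H⟩
      by_cases h : z ∈ Set.univ.pi T
      · rw [Set.indicator_of_mem h, pairWeight_of_forall_lt m ξ (this.2 h)]
      · rw [Set.indicator_of_notMem h, pairWeight_of_not_forall_lt m ξ (mt this.1 h)]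
    simp only [e]
    rw [lintegral_indicator_const (MeasurableSet.univ_pi hTm), tieDensity, prior, Measure.pi_pi]
    congr 1
    rw [← Finset.prod_subset (Finset.subset_univ (Finset.univ \ {i, j}))]
    · refine Finset.prod_congr rfl fun s hs => ?_
      have hs' : ¬(s = i ∨ s = j) := by simpa using hs
      simp only [hT, hs', if_false]
      have : NullSingletonClass (normal (m s) (ξ s)) :=
        nullSingletonClass_gaussianReal (toNNReal_sq_ne_zero (hξ s))
      exact measure_congr Iio_ae_eq_Iic
    · intro s _ hs
      have hs' : s = i ∨ s = j := by
        by_contra hc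
        exact hs (by simpa using hc)
      simp [hT, hs']
  rw [pairMeasure, lintegral_prod_symm' _ (measurable_pairWeight m ξ i j)]
  simp only [hz]
  have ht := measurable_tieDensity m ξ i j
  have ht' : Measurable fun q : ℝ × ℝ => tieDensity m ξ i j q.1 := ht.comp measurable_fst
  rw [lintegral_prod _ ht'.aemeasurable]
  simp [mul_comm, lintegral_mul_const _ ht]

/-- Passing from the reference measure to the prior: near a tie the prior density at
`(μ_i, μ_j) = (x + d, x)` is at least `9 / 10` of the symmetric weight `h_i(x) h_j(x)`. -/
theorem lintegral_pairWeight_mul_le {m ξ : Fin k → ℝ} (hξ : ∀ i, 0 < ξ i) {R w : ℝ} {i j : Fin k}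
    (hij : i ≠ j)
    (hi : ∀ x ∈ Set.Icc (-R) R, ∀ d ∈ Set.Ioc 0 w,
      9 / 10 * normalDensity (m i) (ξ i) x ≤ normalDensity (m i) (ξ i) (x + d))
    {f : (Fin k → ℝ) → ℝ≥0∞} (hf : Measurable f) :
    ENNReal.ofReal (9 / 10) *
        ∫⁻ p, pairWeight m ξ i j p * f (placePair i j p) ∂pairMeasure m ξ R w ≤
      ∫⁻ μ in nearTie R w i j, f μ ∂prior m ξ := by
  set g : (Fin k → ℝ) → ℝ≥0∞ := (nearTie R w i j).indicator f with hg
  have hgm : Measurable g := hf.indicator (measurableSet_nearTie R w i j)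
  have hφ : Measurable fun p => pairWeight m ξ i j p * f (placePair i j p) :=
    (measurable_pairWeight m ξ i j).mul (hf.comp (measurable_placePair i j))
  have hgu : Measurable fun z => ∫⁻ u, g (Function.update z i u) ∂normal (m i) (ξ i) := by
    have := Measurable.lmarginal (fun s => normal (m s) (ξ s)) (s := {i}) hgm
    rwa [lmarginal_singleton] at this
  have hlhs : ∫⁻ μ in nearTie R w i j, f μ ∂prior m ξ =
      ∫⁻ z, (∫⁻ v, ENNReal.ofReal (normalDensity (m j) (ξ j) v) *
        ∫⁻ d, ENNReal.ofReal (normalDensity (m i) (ξ i) (v + d)) *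
          g (placePair i j (z, v, d))) ∂prior m ξ := by
    rw [← lintegral_indicator (measurableSet_nearTie R w i j), prior,
      lintegral_pi_eq_lintegral_update _ i hgm, lintegral_pi_eq_lintegral_update _ j hgu]
    refine lintegral_congr fun z => ?_
    have hgz : Measurable fun v => ∫⁻ u, g (Function.update (Function.update z j v) i u)
        ∂normal (m i) (ξ i) := hgu.comp (measurable_update z)
    rw [lintegral_normal _ (hξ j) hgz]
    refine lintegral_congr fun v => ?_
    congr 1
    have hgv : Measurable fun u => g (Function.update (Function.update z j v) i u) :=
      hgm.comp (measurable_update _)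
    rw [lintegral_normal _ (hξ i) hgv,
      ← lintegral_add_left_eq_self _ v]
    rfl
  rw [hlhs, pairMeasure, lintegral_prod _ hφ.aemeasurable,
    ← lintegral_const_mul _ hφ.lintegral_prod_right']
  refine lintegral_mono fun z => ?_
  have hφz : Measurable fun q : ℝ × ℝ =>
      pairWeight m ξ i j (z, q) * f (placePair i j (z, q)) := hφ.comp measurable_prodMk_left
  rw [lintegral_prod _ hφz.aemeasurable, ← lintegral_const_mul _ hφz.lintegral_prod_right']
  refine (setLIntegral_mono' measurableSet_Icc fun x hx => ?_).trans (setLIntegral_le_lintegral _ _)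
  have hφx : Measurable fun d =>
      pairWeight m ξ i j (z, x, d) * f (placePair i j (z, x, d)) := hφz.comp measurable_prodMk_left
  rw [← lintegral_const_mul _ hφx]
  have hgp : Measurable fun d => ENNReal.ofReal (normalDensity (m i) (ξ i) (x + d)) *
      g (placePair i j (z, x, d)) :=
    Measurable.mul (by fun_prop) (hgm.comp ((measurable_placePair i j).comp (by fun_prop)))
  rw [← lintegral_const_mul _ hgp]
  refine (setLIntegral_mono' measurableSet_Ioc fun d hd => ?_).trans (setLIntegral_le_lintegral _ _)
  by_cases hz : ∀ s, s ≠ i → s ≠ j → z s < x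
  · have hmem : placePair i j (z, x, d) ∈ nearTie R w i j := by
      refine ⟨fun s hsi hsj => ?_, ?_, ?_⟩
      · simpa [placePair_apply, hsi, hsj, hij.symm] using hz s hsi hsj
      · simpa [placePair_apply, hij.symm] using hx
      · simpa [placePair_apply, hij.symm] using hd
    rw [hg, Set.indicator_of_mem hmem, pairWeight_of_forall_lt m ξ hz,
      ← mul_assoc, ← mul_assoc, ← ENNReal.ofReal_mul (by norm_num),
      ← ENNReal.ofReal_mul (normalDensity_nonneg _ _ _)]
    gcongr ENNReal.ofReal ?_ * _
    have := mul_le_mul_of_nonneg_right (hi x hx d hd) (normalDensity_nonneg (m j) (ξ j) x)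
    linarith
  · rw [pairWeight_of_not_forall_lt m ξ hz]
    simp

/-! ### The lower bound -/

/-- The squared distance, in units of the noise, between the two vectors obtained by exchanging
the leading arms. -/
theorem sum_placePair_sub_sq_le {σ : Fin k → ℝ} {v : ℝ} (hv : 0 < v) (hσ : ∀ i, v ≤ σ i ^ 2)
    {i j : Fin k} (hij : i ≠ j) (p : (Fin k → ℝ) × ℝ × ℝ) :
    ∑ s, (placePair i j p s - placePair j i p s) ^ 2 / σ s ^ 2 ≤ 2 * p.2.2 ^ 2 / v := by
  rw [Fintype.sum_eq_add i j hij]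
  · have h : ∀ s, p.2.2 ^ 2 / σ s ^ 2 ≤ p.2.2 ^ 2 / v := fun s => by
      gcongr
      exact hσ s
    have e1 : (placePair i j p i - placePair j i p i) ^ 2 = p.2.2 ^ 2 := by
      simp [placePair_apply, hij]
    have e2 : (placePair i j p j - placePair j i p j) ^ 2 = p.2.2 ^ 2 := by
      simp [placePair_apply, hij.symm]
    rw [e1, e2]
    linarith [h i, h j, show 2 * p.2.2 ^ 2 / v = p.2.2 ^ 2 / v + p.2.2 ^ 2 / v by ring]
  · rintro s ⟨hi, hj⟩
    simp [placePair_apply, hi, hj]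

/-- On a near-tie, an algorithm that takes at most `n` samples cannot tell which of the two leading
arms is the better one; summing over all near-ties bounds its error probability from below. -/
theorem lintegral_pairWeight_le_poe (π : Algorithm k) {m ξ σ : Fin k → ℝ} (hξ : ∀ i, 0 < ξ i)
    (hσ : ∀ i, 0 < σ i) {R w v : ℝ} (hv : 0 < v) (hvσ : ∀ i, v ≤ σ i ^ 2) {n : ℕ}
    (hn : n * (2 * w ^ 2 / v) ≤ Real.log 2)
    (hdens : ∀ i j : Fin k, i ≠ j → ∀ x ∈ Set.Icc (-R) R, ∀ d ∈ Set.Ioc 0 w,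
      9 / 10 * normalDensity (m i) (ξ i) x ≤ normalDensity (m i) (ξ i) (x + d)) :
    ENNReal.ofReal (9 / 40) * ∑ p ∈ (Finset.univ : Finset (Fin k)).offDiag,
        ∫⁻ q, pairWeight m ξ p.1 p.2 q ∂pairMeasure m ξ R w ≤
      2 * π.poe m ξ σ + ∫⁻ μ, π.tailAt σ n μ ∂prior m ξ := by
  have hpair : ∀ p ∈ (Finset.univ : Finset (Fin k)).offDiag,
      ENNReal.ofReal (9 / 40) * ∫⁻ q, pairWeight m ξ p.1 p.2 q ∂pairMeasure m ξ R w ≤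
        (∫⁻ μ in nearTie R w p.1 p.2, π.poeAt σ μ ∂prior m ξ) +
        (∫⁻ μ in nearTie R w p.2 p.1, π.poeAt σ μ ∂prior m ξ) +
        ∫⁻ μ in nearTie R w p.1 p.2, π.tailAt σ n μ ∂prior m ξ := by
    rintro ⟨i, j⟩ hp
    have hij : i ≠ j := by simpa using hp
    have ha := lintegral_pairWeight_mul_le hξ hij (hdens i j hij) (π.measurable_poeAt σ)
    have hb := lintegral_pairWeight_mul_le hξ hij.symm (hdens j i hij.symm) (π.measurable_poeAt σ)
    have hu := lintegral_pairWeight_mul_le hξ hij (hdens i j hij) (π.measurable_tailAt σ n)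
    rw [pairWeight_comm m ξ j i] at hb
    refine le_trans ?_ (add_le_add (add_le_add ha hb) hu)
    have hw := measurable_pairWeight m ξ i j
    have hma : Measurable fun q => pairWeight m ξ i j q * π.poeAt σ (placePair i j q) :=
      hw.mul ((π.measurable_poeAt σ).comp (measurable_placePair i j))
    have hmb : Measurable fun q => pairWeight m ξ i j q * π.poeAt σ (placePair j i q) :=
      hw.mul ((π.measurable_poeAt σ).comp (measurable_placePair j i))
    have hmab : Measurable fun q => pairWeight m ξ i j q * π.poeAt σ (placePair i j q) +
        pairWeight m ξ i j q * π.poeAt σ (placePair j i q) := hma.add hmb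
    rw [← mul_add, ← mul_add, ← lintegral_add_left hma, ← lintegral_add_left hmab]
    have e : ENNReal.ofReal (9 / 40) = ENNReal.ofReal (9 / 10) * ENNReal.ofReal (1 / 4) := by
      rw [← ENNReal.ofReal_mul (by norm_num)]; norm_num
    rw [e, mul_assoc, ← lintegral_const_mul _ hw]
    gcongr ENNReal.ofReal (9 / 10) * ?_
    -- The reference measure is carried by the gaps `d ∈ (0, w]`.
    have hae : ∀ᵐ q ∂pairMeasure m ξ R w, q.2.2 ∈ Set.Ioc 0 w :=
      (Measure.quasiMeasurePreserving_snd.comp Measure.quasiMeasurePreserving_snd).ae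
        (ae_restrict_mem measurableSet_Ioc)
    refine lintegral_mono_ae (hae.mono fun q hq => ?_)
    rw [← mul_add, ← mul_add, mul_comm]
    by_cases hz : ∀ s, s ≠ i → s ≠ j → q.1 s < q.2.1
    · gcongr pairWeight m ξ i j q * ?_
      have h4 : ENNReal.ofReal (1 / 4) = 1 / 4 := by
        rw [ENNReal.ofReal_div_of_pos (by norm_num)]; simp
      rw [h4]
      refine π.quarter_le_poeAt_add hσ hij ?_ ?_ ?_
      · intro s hs
        by_cases hj : s = j
        · simpa [placePair_apply, hj, hij.symm] using hq.1
        · simpa [placePair_apply, hs, hj] using (hz s hs hj).trans (by linarith [hq.1])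
      · intro s hs
        by_cases hi : s = i
        · simpa [placePair_apply, hi, hij] using hq.1
        · simpa [placePair_apply, hs, hi] using (hz s hi hs).trans (by linarith [hq.1])
      · refine le_trans ?_ hn
        gcongr
        refine (sum_placePair_sub_sq_le hv hvσ hij q).trans ?_
        have := hq.1
        gcongr
        exact hq.2
    · rw [pairWeight_of_not_forall_lt m ξ hz]
      simp
  rw [Finset.mul_sum]
  refine (Finset.sum_le_sum hpair).trans ?_
  rw [Finset.sum_add_distrib, Finset.sum_add_distrib, two_mul]
  have hswap : ∑ p ∈ (Finset.univ : Finset (Fin k)).offDiag,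
      ∫⁻ μ in nearTie R w p.2 p.1, π.poeAt σ μ ∂prior m ξ =
      ∑ p ∈ (Finset.univ : Finset (Fin k)).offDiag,
        ∫⁻ μ in nearTie R w p.1 p.2, π.poeAt σ μ ∂prior m ξ :=
    Finset.sum_equiv (Equiv.prodComm _ _) (by simp [ne_comm]) (by simp)
  rw [hswap]
  gcongr <;> exact sum_setLIntegral_nearTie_le R w _ _

/-- Below `δ_L(H)`, an expected sample size of at most `N_V` forces an error probability strictly
larger than `δ`. -/
theorem lt_poe_of_expectedTime_le (hk : 2 ≤ k) {m ξ σ : Fin k → ℝ} (hξ : ∀ i, 0 < ξ i)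
    (hσ : ∀ i, 0 < σ i) {δ : ℝ} (hδ : 0 < δ) (hδL : ENNReal.ofReal δ < deltaL m ξ)
    (π : Algorithm k) (hπ : π.expectedTime m ξ σ ≤ ENNReal.ofReal (NV m ξ σ δ)) :
    ENNReal.ofReal δ < π.poe m ξ σ := by
  have hne : Nonempty (Fin k) := ⟨⟨0, by omega⟩⟩
  have hL : 0 < L m ξ := by
    by_contra! hc
    rw [deltaL, ENNReal.ofReal_of_nonpos (div_nonpos_of_nonpos_of_nonneg hc (by positivity)),
      zero_mul] at hδL
    exact not_lt_zero hδL
  -- `D` is the width scale of the near-ties: `δ = (L / (32 e⁴)) D`.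
  set D := δ * (32 * Real.exp 4) / L m ξ with hDdef
  have hD : 0 < D := by positivity
  have hδD : δ = L m ξ / (32 * Real.exp 4) * D := by rw [hDdef]; field_simp
  have hDmin := hδL
  rw [deltaL, hδD, ENNReal.ofReal_mul (by positivity)] at hDmin
  replace hDmin := lt_of_mul_lt_mul_left' hDmin
  simp only [lt_min_iff] at hDmin
  obtain ⟨⟨hD0, hD1⟩, hDm, hDL⟩ := hDmin
  replace hD0 : D < D0 ξ := (ENNReal.ofReal_lt_ofReal_iff_of_nonneg hD.le).1 hD0
  replace hDL : D < _ := (ENNReal.ofReal_lt_ofReal_iff_of_nonneg hD.le).1 hDL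
  -- In the convention `0⁻¹ = ∞`, `D < y⁻¹` reads `D * y < 1`.
  have hinv : ∀ y : ℝ, 0 ≤ y → ENNReal.ofReal D < (ENNReal.ofReal y)⁻¹ → D * y < 1 := by
    intro y hy h
    rcases hy.eq_or_lt with rfl | hy
    · simp
    · rw [← ENNReal.ofReal_inv_of_pos hy, ENNReal.ofReal_lt_ofReal_iff_of_nonneg hD.le,
        ← one_div, lt_div_iff₀ hy] at h
      exact h
  set r := √D with hrdef
  have hr : 0 < r := Real.sqrt_pos.2 hD
  have hr2 : r ^ 2 = D := Real.sq_sqrt hD.le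
  have hX : 0 < ⨆ i, ξ i :=
    (hξ (Classical.arbitrary _)).trans_le (le_ciSup (Set.finite_range ξ).bddAbove _)
  obtain ⟨hexp, hD1'⟩ := exp_neg_le_of_lt_D0 hX hD hD0
  have hr1 : r ≤ 1 := by nlinarith
  have hm : ∀ i, |m i| * r ≤ 1 / 2 := fun i => by
    have := hinv _ (by positivity) (hDm.trans_le (iInf_le _ i))
    rw [← sq_abs (m i)] at this
    by_contra! hc
    nlinarith
  have hq : ∀ i j, i ≠ j → r * (1 / (2 * ξ i ^ 2)) ≤ 1 := fun i j hij => by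
    have h := hinv _ (sq_nonneg _) (hD1.trans_le
      ((iInf_le _ i).trans <| (iInf_le _ j).trans <| (iInf_le _ hij).trans <| min_le_right _ _))
    have hi : 0 ≤ 1 / (2 * ξ i ^ 2) := by positivity
    have hj : 0 ≤ 1 / (2 * ξ j ^ 2) := by positivity
    by_contra! hc
    have : 1 < r * (1 / (2 * ξ i ^ 2) + 1 / (2 * ξ j ^ 2)) := by nlinarith
    rw [← hr2] at h
    nlinarith
  set v := ⨅ i, σ i ^ 2 with hvdef
  have hvσ : ∀ i, v ≤ σ i ^ 2 := fun i => ciInf_le (Set.finite_range fun i => σ i ^ 2).bddBelow i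
  have hv : 0 < v := by
    obtain ⟨i, hi⟩ := exists_eq_ciInf_of_finite (f := fun i => σ i ^ 2)
    rw [hvdef, ← hi]
    exact pow_pos (hσ i) 2
  -- The factor `1 / 32` balances the weight of the near-ties against the tail of `τ`.
  set w := D / 32 with hw
  have hw0 : 0 < w := by positivity
  set a := v * Real.log 2 / (2 * w ^ 2) with ha
  have hlog : 0 < Real.log 2 := Real.log_pos one_lt_two
  have ha0 : 0 < a := by positivity
  have hNV : NV m ξ σ δ = a * (L m ξ * D / 256) := by
    rw [NV, ← hvdef, hδD, ha, hw]
    field_simp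
    norm_num
  have hn : (⌊a⌋₊ : ℝ) * (2 * w ^ 2 / v) ≤ Real.log 2 := by
    calc (⌊a⌋₊ : ℝ) * (2 * w ^ 2 / v) ≤ a * (2 * w ^ 2 / v) := by
          gcongr
          exact Nat.floor_le ha0.le
      _ = Real.log 2 := by rw [ha]; field_simp
  have hR : ∀ x ∈ Set.Icc (-(1 / r)) (1 / r), |x| * r ≤ 1 := fun x hx => by
    rw [← le_div_iff₀ hr]
    exact abs_le.2 hx
  have hmain := lintegral_pairWeight_le_poe π (m := m) (R := 1 / r) hξ hσ hv hvσ hn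
    fun i j hij x hx d hd => mul_normalDensity_le_normalDensity_add hr hr1 (hm i) (hq i j hij)
      (hR x hx) hd.1.le (by rw [hr2]; exact hd.2)
  have hmass := ofReal_mul_L_le hk hξ hr hm (by rw [hr2]; exact hexp) (by rw [hr2]; exact hDL.le)
  simp only [lintegral_pairWeight hξ] at hmain
  rw [← Finset.mul_sum] at hmain
  have hlow : ENNReal.ofReal (9 / 40 * (w * (15 / 16 * L m ξ))) ≤
      2 * π.poe m ξ σ + ∫⁻ μ, π.tailAt σ ⌊a⌋₊ μ ∂prior m ξ := by
    rw [ENNReal.ofReal_mul (by norm_num), ENNReal.ofReal_mul (by positivity)]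
    exact le_trans (by gcongr) hmain
  have htail : ∫⁻ μ, π.tailAt σ ⌊a⌋₊ μ ∂prior m ξ ≤ ENNReal.ofReal (L m ξ * D / 256) := by
    have h := (π.succ_mul_lintegral_tailAt_le m ξ σ ⌊a⌋₊).trans hπ
    rw [hNV, ENNReal.ofReal_mul ha0.le] at h
    have h1 : ENNReal.ofReal a ≤ (⌊a⌋₊ : ℝ≥0∞) + 1 := by
      rw [ENNReal.ofReal_le_iff_le_toReal (by simp)]
      simpa [ENNReal.toReal_add] using (Nat.lt_floor_add_one a).le
    have h2 := (mul_le_mul_left h1 _).trans h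
    rwa [ENNReal.mul_le_mul_iff_right (by simpa using ha0) ENNReal.ofReal_ne_top] at h2
  by_contra! hc
  have hfin : ENNReal.ofReal (9 / 40 * (w * (15 / 16 * L m ξ))) ≤
      ENNReal.ofReal (2 * δ + L m ξ * D / 256) := by
    refine hlow.trans ?_
    rw [ENNReal.ofReal_add (by positivity) (by positivity), ENNReal.ofReal_mul (by norm_num),
      ENNReal.ofReal_ofNat]
    gcongr
  rw [ENNReal.ofReal_le_ofReal_iff (by positivity)] at hfin
  have he : 25 ≤ Real.exp 4 := by
    have h1 : Real.exp 4 = Real.exp 1 ^ 4 := by rw [← Real.exp_nat_mul]; norm_num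
    have h2 : (2.7 : ℝ) ^ 4 ≤ Real.exp 1 ^ 4 := by
      gcongr
      linarith [Real.exp_one_gt_d9]
    rw [h1]
    exact le_trans (by norm_num) h2
  have hδ' : δ ≤ L m ξ * D / 800 := by
    rw [hδD, div_mul_eq_mul_div]
    gcongr
    linarith
  have hLD : 0 < L m ξ * D := by positivity
  rw [hw] at hfin
  linarith

end BAI

theorem mainTheorem2 (k : ℕ) (hk : 2 ≤ k) (m ξ σ : Fin k → ℝ)
    (hξ : ∀ i, 0 < ξ i) (hσ : ∀ i, 0 < σ i)
    (δ : ℝ) (hδ : 0 < δ) (hδL : ENNReal.ofReal δ < BAI.deltaL m ξ) :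
    (∀ π : BAI.Algorithm k,
      π.expectedTime m ξ σ ≤ ENNReal.ofReal (BAI.NV m ξ σ δ) →
        ENNReal.ofReal δ ≤ π.poe m ξ σ) ∧
    (∀ π : BAI.Algorithm k,
      π.IsBayesCorrect m ξ σ δ →
        ENNReal.ofReal (BAI.NV m ξ σ δ) ≤ π.expectedTime m ξ σ) := by
  have h : ∀ π : BAI.Algorithm k, π.expectedTime m ξ σ ≤ ENNReal.ofReal (BAI.NV m ξ σ δ) →
      ENNReal.ofReal δ < π.poe m ξ σ := BAI.lt_poe_of_expectedTime_le hk hξ hσ hδ hδL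
  refine ⟨fun π hπ => (h π hπ).le, fun π hπ => ?_⟩
  by_contra! hc
  exact absurd (h π hc.le) (not_lt.2 hπ)
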